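/- Let $M$ be a smooth manifold (Hausdorff, second countable, finite-dimensional, without boundary) and let $\omega$ be a symplectic form on $M$, i.e. a smooth, pointwise non-degenerate $2$-form with $d\omega = 0$. Let $\mathfrak X(M)$ be the Lie algebra of smooth vector fields on $M$, with $[u,v](f) = u(v(f)) - v(u(f))$. A vector field $v\in\mathfrak X(M)$ is called symplectic if $\mathcal L_v\omega = 0$, and Hamiltonian with Hamiltonian function $f\in C^\infty(M)$ if $\iota_v\omega = -df$, where $\iota_v\omega = \omega(v,\cdot)$; it is called Hamiltonian if such an $f$ exists. Write $\mathfrak X_{\mathrm{Sym}}(M)$ and $\mathfrak X_{\mathrm{Ham}}(M)$ for the sets of symplectic and of Hamiltonian vector fields. Then: 1. If $v_1,v_2$ are symplectic vector fields, then $[v_1,v_2]$ is Hamiltonian, with Hamiltonian function $\omega(v_1,v_2)$; that is, $\omega(v_1,v_2)$ is smooth and $\iota_{[v_1,v_2]}\omega = -d\big(\omega(v_1,v_2)\big)$. 2. Every Hamiltonian vector field is symplectic, $\mathfrak X_{\mathrm{Sym}}(M)$ is a Lie subalgebra of $\mathfrak X(M)$, $\mathfrak X_{\mathrm{Ham}}(M)$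 is an ideal of $\mathfrak X_{\mathrm{Sym}}(M)$, and the quotient Lie algebra $\mathfrak X_{\mathrm{Sym}}(M)/\mathfrak X_{\mathrm{Ham}}(M)$ is abelian. For every symplectic $v$ the $1$-form $\iota_v\omega$ is closed, and $v\mapsto[\iota_v\omega]$ induces a linear isomorphism $\mathfrak X_{\mathrm{Sym}}(M)/\mathfrak X_{\mathrm{Ham}}(M)\cong H^1(M)$ onto the first de Rham cohomology group (closed $1$-forms modulo exact $1$-forms), which is thus an isomorphism of Lie algebras when $H^1(M)$ carries the zero bracket. -/

import Mathlib

open scoped Manifold ContDiff Topology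

noncomputable section

namespace Symplectic

/-! ### Smooth vector fields and their Lie algebra -/

section VectorFields

theorem natCast_le_infty (n : ℕ) : ((n : ℕ) : WithTop ℕ∞) ≤ ∞ := by
  exact_mod_cast (le_top : (n : ℕ∞) ≤ ⊤)

variable (E : Type*) [NormedAddCommGroup E] [NormedSpace ℝ E]
  (M : Type*) [TopologicalSpace M] [ChartedSpace E M]

/-- The space `𝔛(M)` of smooth vector fields on a manifold `M` modelled on `E`. -/
abbrev VField [IsManifold 𝓘(ℝ, E) ∞ M] : Type _ :=
  ContMDiffSection 𝓘(ℝ, E) E ∞ (fun x : M => TangentSpace 𝓘(ℝ, E) x)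

variable {E M} [IsManifold 𝓘(ℝ, E) ∞ M]

theorem VField.mdifferentiableAt (v : VField E M) (x : M) :
    MDifferentiableAt 𝓘(ℝ, E) (𝓘(ℝ, E).prod 𝓘(ℝ, E))
      (fun y => (Bundle.TotalSpace.mk' E y (v y) : TangentBundle 𝓘(ℝ, E) M)) x :=
  (v.contMDiff x).mdifferentiableAt (by simp)

variable [FiniteDimensional ℝ E]

/-- The Lie bracket of smooth vector fields. -/
instance : Bracket (VField E M) (VField E M) where
  bracket v w :=
    { toFun := VectorField.mlieBracket 𝓘(ℝ, E) v w
      contMDiff_toFun := by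
        have : CompleteSpace E := FiniteDimensional.complete ℝ E
        have : IsManifold 𝓘(ℝ, E) ((∞ : WithTop ℕ∞) + 1) M := by simpa
        have : IsManifold 𝓘(ℝ, E) (minSmoothness ℝ 2) M :=
          .of_le (n := ∞) (by rw [minSmoothness_of_isRCLikeNormedField]; exact natCast_le_infty 2)
        exact ContDiff.mlieBracket_vectorField (n := ⊤) (m := ⊤) v.contMDiff w.contMDiff
          (by simp) }

theorem VField.bracket_apply (v w : VField E M) (x : M) :
    ⁅v, w⁆ x = VectorField.mlieBracket 𝓘(ℝ, E) v w x := rfl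

instance : LieRing (VField E M) where
  add_lie u v w := by
    ext x
    have : IsManifold 𝓘(ℝ, E) 1 M := .of_le (n := ∞) (by simp)
    exact VectorField.mlieBracket_add_left (u.mdifferentiableAt x) (v.mdifferentiableAt x)
  lie_add u v w := by
    ext x
    have : IsManifold 𝓘(ℝ, E) 1 M := .of_le (n := ∞) (by simp)
    exact VectorField.mlieBracket_add_right (v.mdifferentiableAt x) (w.mdifferentiableAt x)
  lie_self v := by
    ext x
    exact congrFun (VectorField.mlieBracket_self (V := v)) x
  leibniz_lie u v w := by
    ext x
    have : CompleteSpace E := FiniteDimensional.complete ℝ E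
    have : IsManifold 𝓘(ℝ, E) (minSmoothness ℝ 3) M :=
      .of_le (n := ∞) (by rw [minSmoothness_of_isRCLikeNormedField]; exact natCast_le_infty 3)
    have h (z : VField E M) := (z.contMDiff x).of_le (m := minSmoothness ℝ 2)
      (by rw [minSmoothness_of_isRCLikeNormedField]; exact natCast_le_infty 2)
    exact VectorField.leibniz_identity_mlieBracket_apply (h u) (h v) (h w)

instance : LieAlgebra ℝ (VField E M) where
  lie_smul c v w := by
    ext x
    have : IsManifold 𝓘(ℝ, E) 1 M := .of_le (n := ∞) (by simp)
    exact VectorField.mlieBracket_const_smul_right (w.mdifferentiableAt x)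

end VectorFields

/-! ### Differential forms -/

section Forms

variable {E : Type*} [NormedAddCommGroup E] [NormedSpace ℝ E]
  {M : Type*} [TopologicalSpace M] [ChartedSpace E M] {k : ℕ}

/-- The expression, in the chart of `M` at `x₀`, of a field `α` of alternating `k`-linear forms:
the pullback of `α` under the inverse of the chart, a `k`-form on (an open subset of) `E`. -/
def inChart (α : (x : M) → TangentSpace 𝓘(ℝ, E) x [⋀^Fin k]→L[ℝ] ℝ) (x₀ : M) (y : E) :
    E [⋀^Fin k]→L[ℝ] ℝ :=
  (α ((extChartAt 𝓘(ℝ, E) x₀).symm y)).compContinuousLinearMap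
    (mfderiv 𝓘(ℝ, E) 𝓘(ℝ, E) (extChartAt 𝓘(ℝ, E) x₀).symm y)

variable (E M k) in
/-- The smooth differential `k`-forms on `M`, as a subspace of all fields of alternating forms. -/
def smoothForms : Submodule ℝ ((x : M) → TangentSpace 𝓘(ℝ, E) x [⋀^Fin k]→L[ℝ] ℝ) where
  carrier := {α | ∀ x₀ : M, ContDiffOn ℝ ∞ (inChart α x₀) (extChartAt 𝓘(ℝ, E) x₀).target}
  add_mem' ha hb x₀ := (ha x₀).add (hb x₀)
  zero_mem' _ := contDiffOn_const (c := 0)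
  smul_mem' c _ ha x₀ := (ha x₀).const_smul c

variable (E M k) in
/-- The space `Ω^k(M)` of smooth differential `k`-forms on `M`. -/
def Form : Type _ := smoothForms E M k

instance : AddCommGroup (Form E M k) := inferInstanceAs (AddCommGroup (smoothForms E M k))

instance : Module ℝ (Form E M k) := inferInstanceAs (Module ℝ (smoothForms E M k))

instance : CoeFun (Form E M k) (fun _ => (x : M) → TangentSpace 𝓘(ℝ, E) x [⋀^Fin k]→L[ℝ] ℝ) where
  coe α := α.1

theorem Form.differentiableAt_inChart (α : Form E M k) {x₀ : M} {y : E}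
    (hy : y ∈ (extChartAt 𝓘(ℝ, E) x₀).target) : DifferentiableAt ℝ (inChart α x₀) y :=
  ((α.2 x₀).contDiffAt ((isOpen_extChartAt_target x₀).mem_nhds hy)).differentiableAt (by simp)

/-- The exterior derivative of a field of alternating forms: at each point it is computed, with the
exterior derivative of the model space, in the chart at this point. -/
def extDerivField (α : (x : M) → TangentSpace 𝓘(ℝ, E) x [⋀^Fin k]→L[ℝ] ℝ) (x : M) :
    TangentSpace 𝓘(ℝ, E) x [⋀^Fin (k + 1)]→L[ℝ] ℝ :=
  (extDeriv (inChart α x) (extChartAt 𝓘(ℝ, E) x x)).compContinuousLinearMap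
    (mfderiv 𝓘(ℝ, E) 𝓘(ℝ, E) (extChartAt 𝓘(ℝ, E) x) x)

variable [IsManifold 𝓘(ℝ, E) ∞ M]

theorem inChart_extDerivField (α : Form E M k) {x₀ : M} {y : E}
    (hy : y ∈ (extChartAt 𝓘(ℝ, E) x₀).target) :
    inChart (extDerivField α) x₀ y = extDeriv (inChart α x₀) y := by
  have hsymm (x : M) : ∀ z ∈ (extChartAt 𝓘(ℝ, E) x).target,
      ContMDiffAt 𝓘(ℝ, E) 𝓘(ℝ, E) ∞ (extChartAt 𝓘(ℝ, E) x).symm z := fun z hz =>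
    (contMDiffOn_extChartAt_symm x).contMDiffAt ((isOpen_extChartAt_target x).mem_nhds hz)
  set p : M := (extChartAt 𝓘(ℝ, E) x₀).symm y with hp
  set τ : E → E := extChartAt 𝓘(ℝ, E) p ∘ (extChartAt 𝓘(ℝ, E) x₀).symm with hτ
  have hev : ∀ᶠ z in 𝓝 y, z ∈ (extChartAt 𝓘(ℝ, E) x₀).target ∧
      (extChartAt 𝓘(ℝ, E) x₀).symm z ∈ (extChartAt 𝓘(ℝ, E) p).source :=
    Filter.Eventually.and ((isOpen_extChartAt_target x₀).mem_nhds hy)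
      ((hsymm x₀ y hy).continuousAt.preimage_mem_nhds (extChartAt_source_mem_nhds p))
  have hφ : ∀ z ∈ (extChartAt 𝓘(ℝ, E) p).source,
      ContMDiffAt 𝓘(ℝ, E) 𝓘(ℝ, E) ∞ (extChartAt 𝓘(ℝ, E) p) z := fun z hz =>
    contMDiffAt_extChartAt' (by simpa using hz)
  have hτs : ∀ z, z ∈ (extChartAt 𝓘(ℝ, E) x₀).target →
      (extChartAt 𝓘(ℝ, E) x₀).symm z ∈ (extChartAt 𝓘(ℝ, E) p).source →
      ContMDiffAt 𝓘(ℝ, E) 𝓘(ℝ, E) ∞ τ z := fun z hz hz' =>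
    (hφ _ hz').comp z (hsymm x₀ z hz)
  have hloc : inChart α x₀ =ᶠ[𝓝 y]
      fun z => (inChart α p (τ z)).compContinuousLinearMap (fderiv ℝ τ z) := by
    filter_upwards [hev.eventually_nhds] with z hz
    have hz0 := hz.self_of_nhds
    have hτz : τ z ∈ (extChartAt 𝓘(ℝ, E) p).target :=
      (extChartAt 𝓘(ℝ, E) p).map_source hz0.2
    have hcomp : (extChartAt 𝓘(ℝ, E) p).symm ∘ τ =ᶠ[𝓝 z] (extChartAt 𝓘(ℝ, E) x₀).symm := by
      filter_upwards [hz] with u hu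
      exact (extChartAt 𝓘(ℝ, E) p).left_inv hu.2
    have hder := hcomp.mfderiv_eq (I := 𝓘(ℝ, E)) (I' := 𝓘(ℝ, E))
    rw [mfderiv_comp z ((hsymm p _ hτz).mdifferentiableAt (by simp))
      ((hτs z hz0.1 hz0.2).mdifferentiableAt (by simp)), mfderiv_eq_fderiv] at hder
    ext w
    have hpt : (extChartAt 𝓘(ℝ, E) p).symm (τ z) = (extChartAt 𝓘(ℝ, E) x₀).symm z :=
      hcomp.self_of_nhds
    let β : M → E [⋀^Fin k]→L[ℝ] ℝ := α.1
    change β _ _ = β _ _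
    rw [hpt]
    congr 1
    funext i
    exact (congrArg (fun L : E →L[ℝ] E => L (w i)) hder).symm
  have hy' : p ∈ (extChartAt 𝓘(ℝ, E) p).source := mem_extChartAt_source p
  have hτd : ContDiffAt ℝ ∞ τ y := (hτs y hy hy').contDiffAt
  have hd : DifferentiableAt ℝ (inChart α p) (τ y) :=
    α.differentiableAt_inChart ((extChartAt 𝓘(ℝ, E) p).map_source hy')
  rw [hloc.extDeriv_eq, extDeriv_pullback hd hτd
    (by rw [minSmoothness_of_isRCLikeNormedField]; exact natCast_le_infty 2)]
  have hder : mfderiv 𝓘(ℝ, E) 𝓘(ℝ, E) τ y = _ :=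
    mfderiv_comp y ((hφ p hy').mdifferentiableAt (by simp))
    ((hsymm x₀ y hy).mdifferentiableAt (by simp))
  rw [mfderiv_eq_fderiv] at hder
  ext w
  change (extDeriv (inChart α p) (τ y)) _ = (extDeriv (inChart α p) (τ y)) _
  congr 1
  funext i
  exact (congrArg (fun L : E →L[ℝ] E => L (w i)) hder).symm

/-- The exterior derivative `d : Ω^k(M) → Ω^{k+1}(M)`. -/
def d (k : ℕ) : Form E M k →ₗ[ℝ] Form E M (k + 1) where
  toFun α := ⟨extDerivField α, fun x₀ => by
    have h : ContDiffOn ℝ ∞ (extDeriv (inChart α x₀)) (extChartAt 𝓘(ℝ, E) x₀).target :=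
      (ContinuousAlternatingMap.alternatizeUncurryFinCLM ℝ E ℝ).contDiff.comp_contDiffOn
        ((α.2 x₀).fderiv_of_isOpen (isOpen_extChartAt_target x₀) (by simp))
    exact h.congr fun y hy => inChart_extDerivField α hy⟩
  map_add' α β := by
    refine Subtype.ext (funext fun x => ?_)
    have h := extDeriv_add (α.differentiableAt_inChart (mem_extChartAt_target x))
      (β.differentiableAt_inChart (mem_extChartAt_target x))
    exact congrArg (fun η : E [⋀^Fin (k + 1)]→L[ℝ] ℝ => η.compContinuousLinearMap
      (mfderiv 𝓘(ℝ, E) 𝓘(ℝ, E) (extChartAt 𝓘(ℝ, E) x) x)) h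
  map_smul' c α := by
    refine Subtype.ext (funext fun x => ?_)
    have h := extDeriv_smul (x := extChartAt 𝓘(ℝ, E) x x) c (inChart α x)
    exact congrArg (fun η : E [⋀^Fin (k + 1)]→L[ℝ] ℝ => η.compContinuousLinearMap
      (mfderiv 𝓘(ℝ, E) 𝓘(ℝ, E) (extChartAt 𝓘(ℝ, E) x) x)) h

variable (E M) in
/-- The first de Rham cohomology `H¹(M)`: closed `1`-forms modulo exact `1`-forms. -/
abbrev DeRhamH1 : Type _ :=
  LinearMap.ker (d (E := E) (M := M) 1) ⧸
    (LinearMap.range (d (E := E) (M := M) 0)).submoduleOf (LinearMap.ker (d (E := E) (M := M) 1))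

variable [FiniteDimensional ℝ E]

/-- The interior product `ι_v α = α(v, ·, …, ·)`. -/
def interior (v : VField E M) (α : Form E M (k + 1)) : Form E M k :=
  ⟨fun x => ContinuousAlternatingMap.curryLeft (E := E) (α x) (v x), fun x₀ => by
    have : CompleteSpace E := FiniteDimensional.complete ℝ E
    let V : E → E := VectorField.mpullback 𝓘(ℝ, E) 𝓘(ℝ, E) (extChartAt 𝓘(ℝ, E) x₀).symm v
    have hinv : ∀ y ∈ (extChartAt 𝓘(ℝ, E) x₀).target,
        (mfderiv 𝓘(ℝ, E) 𝓘(ℝ, E) (extChartAt 𝓘(ℝ, E) x₀).symm y).IsInvertible := fun y hy => by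
      have h := isInvertible_mfderivWithin_extChartAt_symm (I := 𝓘(ℝ, E)) hy
      simpa [mfderivWithin_univ] using h
    have hV : ContDiffOn ℝ ∞ V (extChartAt 𝓘(ℝ, E) x₀).target := fun y hy => by
      have h := ContMDiffAt.mpullback_vectorField_preimage (n := ∞) (m := ∞)
        (f := (extChartAt 𝓘(ℝ, E) x₀).symm) (x₀ := y) (v.contMDiff _)
        ((contMDiffOn_extChartAt_symm x₀).contMDiffAt ((isOpen_extChartAt_target x₀).mem_nhds hy))
        (hinv y hy) (by simp)
      exact (contMDiffAt_vectorSpace_iff_contDiffAt.1 h).contDiffWithinAt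
    have hC : ContDiff ℝ ∞ (fun η : E [⋀^Fin (k + 1)]→L[ℝ] ℝ => η.curryLeft) :=
      ContinuousLinearMap.contDiff (𝕜 := ℝ) (E := E [⋀^Fin (k + 1)]→L[ℝ] ℝ)
        (F := E →L[ℝ] E [⋀^Fin k]→L[ℝ] ℝ)
        ContinuousAlternatingMap.curryLeftLI.toContinuousLinearMap
    have hc : ContDiffOn ℝ ∞ (fun y => ContinuousAlternatingMap.curryLeft (inChart α x₀ y) (V y))
        (extChartAt 𝓘(ℝ, E) x₀).target :=
      ContDiffOn.clm_apply (f := fun y => ContinuousAlternatingMap.curryLeft (inChart α x₀ y))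
        (hC.comp_contDiffOn (α.2 x₀)) hV
    refine hc.congr fun y hy => ?_
    ext w
    change α _ _ = α _ _
    congr 1
    funext i
    refine Fin.cases ?_ (fun j => rfl) i
    exact ((hinv y hy).self_apply_inverse (v _)).symm⟩

theorem interior_apply (v : VField E M) (α : Form E M (k + 1)) (x : M)
    (w : Fin k → TangentSpace 𝓘(ℝ, E) x) :
    interior v α x w = α x (Matrix.vecCons (v x) w) := rfl

/-- The Lie derivative `L_v α` of a `k`-form `α`, evaluated on the vector fields `X₁, …, X_k`:
`(L_v α)(X₁, …, X_k) = v(α(X₁, …, X_k)) - ∑ᵢ α(X₁, …, [v, Xᵢ], …, X_k)`. -/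
def lieDerivative (v : VField E M) (α : Form E M k) (X : Fin k → VField E M) (x : M) : ℝ :=
  mvfderiv 𝓘(ℝ, E) (fun y => α y (fun i => X i y)) x (v x) -
    ∑ i, α x (Function.update (fun j => X j x) i (⁅v, X i⁆ x))

end Forms

/-! ### Symplectic manifolds -/

section Symplectic

variable (E : Type*) [NormedAddCommGroup E] [NormedSpace ℝ E]
  (M : Type*) [TopologicalSpace M] [ChartedSpace E M] [IsManifold 𝓘(ℝ, E) ∞ M]

/-- A symplectic form on `M`: a closed, pointwise non-degenerate smooth `2`-form. -/
structure SymplecticForm where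
  toForm : Form E M 2
  closed : d 2 toForm = 0
  nondegenerate : ∀ (x : M) (v : TangentSpace 𝓘(ℝ, E) x),
    (∀ w : TangentSpace 𝓘(ℝ, E) x, toForm x ![v, w] = 0) → v = 0

variable {E M} [FiniteDimensional ℝ E]

/-- `v` is symplectic: it preserves `σ`, that is, `L_v σ = 0`. -/
def IsSymplectic (σ : SymplecticForm E M) (v : VField E M) : Prop :=
  ∀ (X : Fin 2 → VField E M) (x : M), lieDerivative v σ.toForm X x = 0

/-- `v` is Hamiltonian with Hamiltonian function `f`: `f` is smooth and `ι_v σ = -df`. -/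
def IsHamiltonianWith (σ : SymplecticForm E M) (v : VField E M) (f : M → ℝ) : Prop :=
  ContMDiff 𝓘(ℝ, E) 𝓘(ℝ, ℝ) ∞ f ∧
    ∀ (x : M) (w : TangentSpace 𝓘(ℝ, E) x),
      interior v σ.toForm x ![w] = -mvfderiv 𝓘(ℝ, E) f x w

/-- `v` is Hamiltonian. -/
def IsHamiltonian (σ : SymplecticForm E M) (v : VField E M) : Prop :=
  ∃ f : M → ℝ, IsHamiltonianWith σ v f

end Symplectic

end Symplectic

end

/-! Everything is read off from the `1`-form `ι_v σ`. Since `dσ = 0`, Cartan's formula gives `L_v σ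
= d(ι_v σ)`, so `v` is symplectic iff `ι_v σ` is closed (`isSymplectic_iff`) and Hamiltonian iff it
is exact (`isHamiltonian_iff`); `d ∘ d = 0` gives one inclusion.

For symplectic `u`, `v`, combining the invariant formulas for `dσ`, `d(ι_u σ)` and `d(ι_v σ)`, all
zero, yields `ι_[u,v] σ = -d(σ(u, v))` (`IsSymplectic.bracket`). The subalgebra, the ideal and the
abelian quotient all follow from this.

By non-degeneracy `v ↦ ι_v σ` reaches every `1`-form, with a smooth `v` because operator inversion
is smooth (`SymplecticForm.interiorₗ_surjective`). Hence symplectic fields map onto `H¹(M)` with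
kernel the Hamiltonian fields, and the first isomorphism theorem concludes. -/

noncomputable section
namespace Symplectic

/-! ### Chart expressions, the invariant formula for `d`, and Cartan's formula -/

section Chart
variable {E : Type*} [NormedAddCommGroup E] [NormedSpace ℝ E]
  {M : Type*} [TopologicalSpace M] [ChartedSpace E M] [IsManifold 𝓘(ℝ, E) ∞ M] {n k : ℕ}

theorem contMDiffAt_extChartAt_symm {x₀ : M} {y : E} (hy : y ∈ (extChartAt 𝓘(ℝ, E) x₀).target) :
    ContMDiffAt 𝓘(ℝ, E) 𝓘(ℝ, E) ∞ (extChartAt 𝓘(ℝ, E) x₀).symm y :=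
  (contMDiffOn_extChartAt_symm x₀).contMDiffAt ((isOpen_extChartAt_target x₀).mem_nhds hy)

theorem isInvertible_mfderiv_extChartAt_symm {x₀ : M} {y : E}
    (hy : y ∈ (extChartAt 𝓘(ℝ, E) x₀).target) :
    (mfderiv 𝓘(ℝ, E) 𝓘(ℝ, E) (extChartAt 𝓘(ℝ, E) x₀).symm y).IsInvertible := by
  have : IsManifold 𝓘(ℝ, E) 1 M := .of_le (n := ∞) (by simp)
  simpa [mfderivWithin_univ] using isInvertible_mfderivWithin_extChartAt_symm (I := 𝓘(ℝ, E)) hy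

/-- The expression of a vector field in the chart at `x₀`. -/
def VField.inChart (v : VField E M) (x₀ : M) : E → E :=
  VectorField.mpullback 𝓘(ℝ, E) 𝓘(ℝ, E) (extChartAt 𝓘(ℝ, E) x₀).symm v

theorem VField.mfderiv_inChart (v : VField E M) {x₀ : M} {y : E}
    (hy : y ∈ (extChartAt 𝓘(ℝ, E) x₀).target) :
    mfderiv 𝓘(ℝ, E) 𝓘(ℝ, E) (extChartAt 𝓘(ℝ, E) x₀).symm y (v.inChart x₀ y) =
      v ((extChartAt 𝓘(ℝ, E) x₀).symm y) :=
  (isInvertible_mfderiv_extChartAt_symm hy).self_apply_inverse (v _)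

theorem inChart_apply_inChart (α : (x : M) → TangentSpace 𝓘(ℝ, E) x [⋀^Fin k]→L[ℝ] ℝ)
    (X : Fin k → VField E M) {x₀ : M} {y : E} (hy : y ∈ (extChartAt 𝓘(ℝ, E) x₀).target) :
    inChart α x₀ y (fun i => (X i).inChart x₀ y) =
      α ((extChartAt 𝓘(ℝ, E) x₀).symm y) (fun i => X i ((extChartAt 𝓘(ℝ, E) x₀).symm y)) := by
  change α _ _ = α _ _
  congr 1
  funext i
  exact (X i).mfderiv_inChart hy

omit [IsManifold 𝓘(ℝ, E) ∞ M] in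
theorem Form.ext {α β : Form E M k} (h : ∀ x, α x = β x) : α = β := Subtype.ext (funext h)

omit [IsManifold 𝓘(ℝ, E) ∞ M] in
theorem Form.two_swap (α : Form E M 2) (x : M) (u v : TangentSpace 𝓘(ℝ, E) x) :
    α x ![u, v] = -α x ![v, u] := by
  have h := (α x).toAlternatingMap.map_swap ![v, u] (i := 0) (j := 1) (by simp)
  refine Eq.trans ?_ h
  change α x _ = α x _
  congr 1
  funext j; fin_cases j <;> simp

/-- `TangentSpace` at `x` is `E` seen through the preferred chart at `x`, so this chart and its
inverse have identity derivative at the base point. The next two lemmas rest on the same fact. -/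
theorem VField.inChart_self (v : VField E M) (x : M) :
    v.inChart x (extChartAt 𝓘(ℝ, E) x x) = v x := by
  have : IsManifold 𝓘(ℝ, E) 1 M := .of_le (n := ∞) (by simp)
  have h := v.mfderiv_inChart (mem_extChartAt_target (I := 𝓘(ℝ, E)) x)
  rw [← mfderivWithin_univ, ← ModelWithCorners.range_eq_univ 𝓘(ℝ, E),
    mfderivWithin_range_extChartAt_symm] at h
  let V : M → E := v
  change _ = V x
  refine h.trans ?_
  change V _ = V x
  rw [extChartAt_to_inv]

theorem inChart_self (α : (x : M) → TangentSpace 𝓘(ℝ, E) x [⋀^Fin k]→L[ℝ] ℝ) (x : M) :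
    inChart α x (extChartAt 𝓘(ℝ, E) x x) = α x := by
  have : IsManifold 𝓘(ℝ, E) 1 M := .of_le (n := ∞) (by simp)
  rw [inChart, ← mfderivWithin_univ, ← ModelWithCorners.range_eq_univ 𝓘(ℝ, E),
    mfderivWithin_range_extChartAt_symm]
  let β : M → E [⋀^Fin k]→L[ℝ] ℝ := α
  change (β _).compContinuousLinearMap (ContinuousLinearMap.id ℝ E) = β x
  rw [extChartAt_to_inv]
  rfl

theorem extDerivField_self (α : (x : M) → TangentSpace 𝓘(ℝ, E) x [⋀^Fin k]→L[ℝ] ℝ) (x : M) :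
    extDerivField α x = extDeriv (inChart α x) (extChartAt 𝓘(ℝ, E) x x) := by
  have : IsManifold 𝓘(ℝ, E) 1 M := .of_le (n := ∞) (by simp)
  rw [extDerivField, mfderiv_extChartAt_self]
  rfl

theorem d_d (α : Form E M k) : d (k + 1) (d k α) = 0 := by
  refine Form.ext fun x => ?_
  have hx := mem_extChartAt_target (I := 𝓘(ℝ, E)) x
  change extDerivField (d k α) x = 0
  rw [extDerivField_self]
  -- Equality is needed on a neighbourhood, not only at the point, because it is differentiated once
  -- more.
  have h : inChart (d k α) x =ᶠ[𝓝 (extChartAt 𝓘(ℝ, E) x x)] extDeriv (inChart α x) := by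
    filter_upwards [(isOpen_extChartAt_target x).mem_nhds hx] with y hy
    exact inChart_extDerivField α hy
  rw [h.extDeriv_eq]
  exact extDeriv_extDeriv_apply ((α.2 x).contDiffAt ((isOpen_extChartAt_target x).mem_nhds hx))
    (by rw [minSmoothness_of_isRCLikeNormedField]; exact natCast_le_infty 2)

theorem mvfderiv_apply_eq_fderiv {g : M → ℝ} {x : M} {G : E → ℝ}
    (hG : DifferentiableAt ℝ G (extChartAt 𝓘(ℝ, E) x x))
    (h : ∀ y ∈ (extChartAt 𝓘(ℝ, E) x).target, G y = g ((extChartAt 𝓘(ℝ, E) x).symm y)) :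
    mvfderiv 𝓘(ℝ, E) g x = fderiv ℝ G (extChartAt 𝓘(ℝ, E) x x) := by
  have : IsManifold 𝓘(ℝ, E) 1 M := .of_le (n := ∞) (by simp)
  have hg : g =ᶠ[𝓝 x] G ∘ extChartAt 𝓘(ℝ, E) x := by
    filter_upwards [extChartAt_source_mem_nhds (I := 𝓘(ℝ, E)) x] with z hz
    simp only [Function.comp_apply]
    rw [h _ ((extChartAt 𝓘(ℝ, E) x).map_source hz), (extChartAt 𝓘(ℝ, E) x).left_inv hz]
  have h1 : mfderiv 𝓘(ℝ, E) 𝓘(ℝ, ℝ) (G ∘ extChartAt 𝓘(ℝ, E) x) x = _ :=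
    mfderiv_comp x hG.mdifferentiableAt
      ((contMDiffAt_extChartAt (n := ∞)).mdifferentiableAt (by simp))
  rw [mvfderiv, hg.mfderiv_eq, h1, mfderiv_eq_fderiv, mfderiv_extChartAt_self]
  rfl

variable [FiniteDimensional ℝ E]

theorem VField.contDiffOn_inChart (v : VField E M) (x₀ : M) :
    ContDiffOn ℝ ∞ (v.inChart x₀) (extChartAt 𝓘(ℝ, E) x₀).target := fun y hy => by
  have : CompleteSpace E := FiniteDimensional.complete ℝ E
  have h := ContMDiffAt.mpullback_vectorField_preimage (n := ∞) (m := ∞)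
    (f := (extChartAt 𝓘(ℝ, E) x₀).symm) (x₀ := y) (v.contMDiff _)
    (contMDiffAt_extChartAt_symm hy) (isInvertible_mfderiv_extChartAt_symm hy) (by simp)
  exact (contMDiffAt_vectorSpace_iff_contDiffAt.1 h).contDiffWithinAt

theorem VField.differentiableAt_inChart (v : VField E M) {x₀ : M} {y : E}
    (hy : y ∈ (extChartAt 𝓘(ℝ, E) x₀).target) : DifferentiableAt ℝ (v.inChart x₀) y :=
  ((v.contDiffOn_inChart x₀).contDiffAt
    ((isOpen_extChartAt_target x₀).mem_nhds hy)).differentiableAt (by simp)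

/-- Naturality of the Lie bracket under pullback by the inverse chart; on `E` the manifold bracket
is the usual one. -/
theorem VField.bracket_inChart (v w : VField E M) {x₀ : M} {y : E}
    (hy : y ∈ (extChartAt 𝓘(ℝ, E) x₀).target) :
    VField.inChart ⁅v, w⁆ x₀ y = VectorField.lieBracket ℝ (v.inChart x₀) (w.inChart x₀) y := by
  have : CompleteSpace E := FiniteDimensional.complete ℝ E
  have : IsManifold 𝓘(ℝ, E) (minSmoothness ℝ 2) M :=
    .of_le (n := ∞) (by rw [minSmoothness_of_isRCLikeNormedField]; exact natCast_le_infty 2)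
  have h := VectorField.mpullback_mlieBracket (𝕜 := ℝ) (I := 𝓘(ℝ, E)) (I' := 𝓘(ℝ, E)) (n := ∞)
    (v.mdifferentiableAt _) (w.mdifferentiableAt _)
    (contMDiffAt_extChartAt_symm hy)
    (by rw [minSmoothness_of_isRCLikeNormedField]; exact natCast_le_infty 2)
  refine h.trans ?_
  rw [← VectorField.mlieBracketWithin_univ, VectorField.mlieBracketWithin_eq_lieBracketWithin,
    ← VectorField.lieBracketWithin_univ]
  rfl

theorem mvfderiv_form_apply (α : Form E M k) (X : Fin k → VField E M) (x : M) :
    mvfderiv 𝓘(ℝ, E) (fun y => α y (fun i => X i y)) x =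
      fderiv ℝ (fun y => inChart α x y (fun i => (X i).inChart x y))
        (extChartAt 𝓘(ℝ, E) x x) := by
  have hx := mem_extChartAt_target (I := 𝓘(ℝ, E)) x
  exact mvfderiv_apply_eq_fderiv (DifferentiableAt.continuousAlternatingMap_apply
    (α.differentiableAt_inChart hx) fun i => (X i).differentiableAt_inChart hx)
    fun y hy => inChart_apply_inChart α.1 X hy

/-- The invariant formula for the exterior derivative. -/
theorem d_apply_vectorField (α : Form E M (n + 1)) (X : Fin (n + 2) → VField E M) (x : M) :
    d (n + 1) α x (fun i => X i x) =
      (∑ i, (-1) ^ i.val • mvfderiv 𝓘(ℝ, E) (fun y => α y (fun j => i.removeNth X j y)) x (X i x)) -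
        -- The pair of fields is `(i, j + 1)`, whose usual sign `(-1)^(i+j+1)` is split into
        -- `(-1)^(i+j)` and the minus in front.
        ∑ i : Fin (n + 1), ∑ j ≥ i, (-1) ^ (i + j : ℕ) •
          α x (Matrix.vecCons (⁅X i.castSucc, X j.succ⁆ x)
            (fun l => j.removeNth (i.castSucc.removeNth X) l x)) := by
  have hx := mem_extChartAt_target (I := 𝓘(ℝ, E)) x
  have h := extDeriv_apply_vectorField (V := fun i => (X i).inChart x)
    (α.differentiableAt_inChart hx) (fun i => (X i).differentiableAt_inChart hx)
  simp only [← VField.bracket_inChart _ _ hx, VField.inChart_self, inChart_self] at h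
  simp only [mvfderiv_form_apply]
  refine Eq.trans ?_ h
  change extDerivField α x _ = _
  rw [extDerivField_self]
  rfl

theorem d_one_apply (α : Form E M 1) (u v : VField E M) (x : M) :
    d 1 α x ![u x, v x] =
      mvfderiv 𝓘(ℝ, E) (fun y => α y ![v y]) x (u x) -
        mvfderiv 𝓘(ℝ, E) (fun y => α y ![u y]) x (v x) - α x ![⁅u, v⁆ x] := by
  have h := d_apply_vectorField α ![u, v] x
  have e1 : (fun y => α y (fun j => (0 : Fin 2).removeNth ![u, v] j y)) = fun y => α y ![v y] := by
    funext y; congr 1; funext j; fin_cases j; rfl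
  have e2 : (fun y => α y (fun j => (1 : Fin 2).removeNth ![u, v] j y)) = fun y => α y ![u y] := by
    funext y; congr 1; funext j; fin_cases j; rfl
  have e3 : (fun i => ![u, v] i x) = ![u x, v x] := by
    funext j; fin_cases j <;> rfl
  rw [Fin.sum_univ_two, e1, e2, e3] at h
  have s0 : Finset.Ici (0 : Fin 1) = {0} := rfl
  have e4 : (fun l => (0 : Fin 1).removeNth ((0 : Fin 1).castSucc.removeNth ![u, v]) l x) = ![] :=
    Subsingleton.elim _ _
  rw [Fin.sum_univ_one, s0, Finset.sum_singleton, e4] at h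
  rw [h]
  simp [sub_eq_add_neg]

theorem d_two_apply (α : Form E M 2) (u v w : VField E M) (x : M) :
    d 2 α x ![u x, v x, w x] =
      mvfderiv 𝓘(ℝ, E) (fun y => α y ![v y, w y]) x (u x) -
        mvfderiv 𝓘(ℝ, E) (fun y => α y ![u y, w y]) x (v x) +
        mvfderiv 𝓘(ℝ, E) (fun y => α y ![u y, v y]) x (w x) - α x ![⁅u, v⁆ x, w x]
        + α x ![⁅u, w⁆ x, v x] - α x ![⁅v, w⁆ x, u x] := by
  have h := d_apply_vectorField α ![u, v, w] x
  have e1 : (fun y => α y (fun j => (0 : Fin 3).removeNth ![u, v, w] j y)) =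
      fun y => α y ![v y, w y] := by
    funext y; congr 1; funext j; fin_cases j <;> rfl
  have e2 : (fun y => α y (fun j => (1 : Fin 3).removeNth ![u, v, w] j y)) =
      fun y => α y ![u y, w y] := by
    funext y; congr 1; funext j; fin_cases j <;> rfl
  have e3 : (fun y => α y (fun j => (2 : Fin 3).removeNth ![u, v, w] j y)) =
      fun y => α y ![u y, v y] := by
    funext y; congr 1; funext j; fin_cases j <;> rfl
  have e4 : (fun i => ![u, v, w] i x) = ![u x, v x, w x] := by
    funext j; fin_cases j <;> rfl
  rw [Fin.sum_univ_three, e1, e2, e3, e4] at h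
  have s0 : Finset.Ici (0 : Fin 2) = {0, 1} := rfl
  have s1 : Finset.Ici (1 : Fin 2) = {1} := rfl
  have e5 : (fun l => (0 : Fin 2).removeNth ((0 : Fin 2).castSucc.removeNth ![u, v, w]) l x) =
      ![w x] := by
    funext j; fin_cases j; rfl
  have e6 : (fun l => (1 : Fin 2).removeNth ((0 : Fin 2).castSucc.removeNth ![u, v, w]) l x) =
      ![v x] := by
    funext j; fin_cases j; rfl
  have e7 : (fun l => (1 : Fin 2).removeNth ((1 : Fin 2).castSucc.removeNth ![u, v, w]) l x) =
      ![u x] := by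
    funext j; fin_cases j; rfl
  rw [Fin.sum_univ_two, s0, s1, Finset.sum_pair (by simp), Finset.sum_singleton, e5, e6, e7] at h
  rw [h]
  simp
  ring

/-- Every tangent vector is the value of a smooth vector field. -/
theorem VField.exists_apply_eq [T2Space M] (x : M) (w : TangentSpace 𝓘(ℝ, E) x) :
    ∃ X : VField E M, X x = w := by
  obtain ⟨s, hs, hsm⟩ := FiberBundle.exists_contMDiffOn_extend (I := 𝓘(ℝ, E)) (k := ∞) E
    (V := fun y : M => TangentSpace 𝓘(ℝ, E) y) w
  obtain ⟨u, hus, huo, hxu⟩ := mem_nhds_iff.1 hs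
  -- A bump function supported where the local extension is smooth makes the product globally
  -- smooth; its value `1` at `x` preserves `w`.
  obtain ⟨f, -, hf⟩ := (SmoothBumpFunction.nhds_basis_tsupport (I := 𝓘(ℝ, E)) x).mem_iff.1
    (huo.mem_nhds hxu)
  refine ⟨⟨_, ContMDiffOn.smul_section_of_tsupport f.contMDiff.contMDiffOn huo hf
    (hsm.mono hus)⟩, ?_⟩
  change f x • FiberBundle.extend E w x = w
  rw [f.eq_one, one_smul, FiberBundle.extend_apply_self]

/-- Cartan's formula for closed `2`-forms. -/
theorem lieDerivative_eq_d_interior (v : VField E M) (α : Form E M 2) (hα : d 2 α = 0)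
    (X : Fin 2 → VField E M) (x : M) :
    lieDerivative v α X x = d 1 (interior v α) x (fun i => X i x) := by
  obtain ⟨X, Y, rfl⟩ : ∃ Y Z, X = ![Y, Z] := ⟨X 0, X 1, by funext i; fin_cases i <;> rfl⟩
  -- The two sides of the goal differ by exactly `dα(v, X, Y)`.
  have h := d_two_apply α v X Y x
  rw [hα] at h
  have e : (fun i => ![X, Y] i x) = ![X x, Y x] := by funext i; fin_cases i <;> rfl
  have e' : (fun y => α y (fun i => ![X, Y] i y)) = fun y => α y ![X y, Y y] := by
    funext y; congr 1; funext i; fin_cases i <;> rfl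
  rw [e, d_one_apply, lieDerivative, e', Fin.sum_univ_two]
  simp only [interior_apply]
  have f0 : Function.update (fun j => ![X, Y] j x) 0 (⁅v, ![X, Y] 0⁆ x) = ![⁅v, X⁆ x, Y x] := by
    funext i; fin_cases i <;> rfl
  have f1 : Function.update (fun j => ![X, Y] j x) 1 (⁅v, ![X, Y] 1⁆ x) = ![X x, ⁅v, Y⁆ x] := by
    funext i; fin_cases i <;> rfl
  rw [f0, f1, α.two_swap x (v x) (⁅X, Y⁆ x), α.two_swap x (X x) (⁅v, Y⁆ x)]
  change (0 : ℝ) = _ at h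
  linarith

end Chart

/-! ### Smooth functions as `0`-forms -/

section Functions
variable {E : Type*} [NormedAddCommGroup E] [NormedSpace ℝ E]
  {M : Type*} [TopologicalSpace M] [ChartedSpace E M] [IsManifold 𝓘(ℝ, E) ∞ M]

theorem contDiffOn_comp_extChartAt_symm {f : M → ℝ} (hf : ContMDiff 𝓘(ℝ, E) 𝓘(ℝ, ℝ) ∞ f) (x₀ : M) :
    ContDiffOn ℝ ∞ (f ∘ (extChartAt 𝓘(ℝ, E) x₀).symm) (extChartAt 𝓘(ℝ, E) x₀).target :=
  (hf.comp_contMDiffOn (contMDiffOn_extChartAt_symm x₀)).contDiffOn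

/-- A smooth function, as a `0`-form. -/
def Form.ofFun (f : M → ℝ) (hf : ContMDiff 𝓘(ℝ, E) 𝓘(ℝ, ℝ) ∞ f) : Form E M 0 :=
  ⟨fun x => ContinuousAlternatingMap.constOfIsEmpty ℝ (TangentSpace 𝓘(ℝ, E) x) (Fin 0) (f x),
    fun x₀ => (ContinuousAlternatingMap.constOfIsEmptyLIE ℝ E ℝ (Fin 0)).contDiff.comp_contDiffOn
      (contDiffOn_comp_extChartAt_symm hf x₀)⟩

theorem d_ofFun_apply {f : M → ℝ} (hf : ContMDiff 𝓘(ℝ, E) 𝓘(ℝ, ℝ) ∞ f) (x : M)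
    (w : TangentSpace 𝓘(ℝ, E) x) :
    d 0 (Form.ofFun f hf) x ![w] = mvfderiv 𝓘(ℝ, E) f x w := by
  have hx := mem_extChartAt_target (I := 𝓘(ℝ, E)) x
  rw [mvfderiv_apply_eq_fderiv (G := f ∘ (extChartAt 𝓘(ℝ, E) x).symm)
    (((contDiffOn_comp_extChartAt_symm hf x).contDiffAt
      ((isOpen_extChartAt_target x).mem_nhds hx)).differentiableAt (by simp)) fun _ _ => rfl]
  change extDerivField _ x _ = _
  rw [extDerivField_self]
  exact congrArg (fun η : E [⋀^Fin 1]→L[ℝ] ℝ => η ![w])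
    (extDeriv_constOfIsEmpty (f ∘ (extChartAt 𝓘(ℝ, E) x).symm) (extChartAt 𝓘(ℝ, E) x x))

omit [IsManifold 𝓘(ℝ, E) ∞ M] in
theorem Form.contMDiff_apply_empty (α : Form E M 0) :
    ContMDiff 𝓘(ℝ, E) 𝓘(ℝ, ℝ) ∞ (fun x => α x ![]) := fun x => by
  have hx := mem_extChartAt_target (I := 𝓘(ℝ, E)) x
  have h : ContDiffOn ℝ ∞ (fun y => inChart α x y ![]) (extChartAt 𝓘(ℝ, E) x).target :=
    ((ContinuousAlternatingMap.constOfIsEmptyLIE ℝ E ℝ (Fin 0)).symm.contDiff.comp_contDiffOn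
      (α.2 x)).congr fun y _ => congrArg (inChart α x y) (Subsingleton.elim _ _)
  have h' := ((h.contDiffAt ((isOpen_extChartAt_target x).mem_nhds hx)).contMDiffAt).comp x
    (contMDiffAt_extChartAt (I := 𝓘(ℝ, E)) (n := ∞))
  refine h'.congr_of_eventuallyEq ?_
  filter_upwards [extChartAt_source_mem_nhds (I := 𝓘(ℝ, E)) x] with z hz
  let β : M → E [⋀^Fin 0]→L[ℝ] ℝ := α
  change β z _ = β ((extChartAt 𝓘(ℝ, E) x).symm (extChartAt 𝓘(ℝ, E) x z)) _
  rw [(extChartAt 𝓘(ℝ, E) x).left_inv hz]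
  congr 1
  exact Subsingleton.elim _ _

theorem Form.ofFun_apply_empty (α : Form E M 0) :
    Form.ofFun (fun x => α x ![]) α.contMDiff_apply_empty = α := by
  refine Form.ext fun x => ?_
  ext m
  change α x ![] = α x m
  congr 1
  exact Subsingleton.elim _ _

omit [IsManifold 𝓘(ℝ, E) ∞ M] in
theorem Form.one_ext {α β : Form E M 1} (h : ∀ (x : M) (w : TangentSpace 𝓘(ℝ, E) x),
    α x ![w] = β x ![w]) : α = β := by
  refine Form.ext fun x => ?_
  ext m
  have hm : m = ![m 0] := by funext i; fin_cases i; rfl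
  rw [hm]
  exact h x (m 0)

/-- Bridge between exactness in `DeRhamH1`, phrased with `0`-forms, and the functions used in
`IsHamiltonianWith`. -/
theorem mem_range_d_zero_iff (β : Form E M 1) :
    β ∈ LinearMap.range (d (E := E) (M := M) 0) ↔
      ∃ f : M → ℝ, ContMDiff 𝓘(ℝ, E) 𝓘(ℝ, ℝ) ∞ f ∧
        ∀ (x : M) (w : TangentSpace 𝓘(ℝ, E) x), β x ![w] = mvfderiv 𝓘(ℝ, E) f x w := by
  constructor
  · rintro ⟨α, rfl⟩
    refine ⟨_, α.contMDiff_apply_empty, fun x w => ?_⟩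
    rw [← d_ofFun_apply α.contMDiff_apply_empty, α.ofFun_apply_empty]
  · rintro ⟨f, hf, h⟩
    refine ⟨Form.ofFun f hf, Form.one_ext fun x w => ?_⟩
    rw [d_ofFun_apply, h]

end Functions

/-! ### Symplectic and Hamiltonian fields through closed and exact `1`-forms -/

section Symplectic
variable {E : Type*} [NormedAddCommGroup E] [NormedSpace ℝ E] [FiniteDimensional ℝ E]
  {M : Type*} [TopologicalSpace M] [ChartedSpace E M] [IsManifold 𝓘(ℝ, E) ∞ M]

/-- The linear map `v ↦ ι_v α`. -/
def interiorₗ {k : ℕ} (α : Form E M (k + 1)) : VField E M →ₗ[ℝ] Form E M k where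
  toFun v := interior v α
  map_add' u v := Form.ext fun x =>
    (ContinuousAlternatingMap.curryLeft (E := E) (α x)).map_add (u x) (v x)
  map_smul' c v := Form.ext fun x =>
    (ContinuousAlternatingMap.curryLeft (E := E) (α x)).map_smul c (v x)

theorem isHamiltonian_iff (σ : SymplecticForm E M) (v : VField E M) :
    IsHamiltonian σ v ↔ interior v σ.toForm ∈ LinearMap.range (d (E := E) (M := M) 0) := by
  -- The sign in `ι_v σ = -df` is harmless: the exact forms are a subspace.
  rw [← neg_mem_iff, mem_range_d_zero_iff]
  refine exists_congr fun f => and_congr_right fun _ => forall₂_congr fun x w => ?_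
  change _ ↔ -(interior v σ.toForm x ![w]) = _
  rw [neg_eq_iff_eq_neg]

section
variable [T2Space M]

/-- `IsSymplectic` tests `L_v σ` on global vector fields; it determines the form `d(ι_v σ)`
pointwise because every tangent vector extends to such a field. -/
theorem isSymplectic_iff (σ : SymplecticForm E M) (v : VField E M) :
    IsSymplectic σ v ↔ d 1 (interior v σ.toForm) = 0 := by
  refine ⟨fun h => Form.ext fun x => ?_, fun h X x => ?_⟩
  · ext m
    choose X hX using fun i => VField.exists_apply_eq x (m i)
    have := h X x
    rw [lieDerivative_eq_d_interior v _ σ.closed] at this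
    simp only [hX] at this
    exact this
  · rw [lieDerivative_eq_d_interior v _ σ.closed, h]
    rfl

theorem IsHamiltonian.isSymplectic {σ : SymplecticForm E M} {v : VField E M}
    (h : IsHamiltonian σ v) : IsSymplectic σ v := by
  rw [isSymplectic_iff]
  obtain ⟨α, hα⟩ := (isHamiltonian_iff σ v).1 h
  rw [← hα, d_d]

theorem IsSymplectic.bracket {σ : SymplecticForm E M} {u v : VField E M}
    (hu : IsSymplectic σ u) (hv : IsSymplectic σ v) :
    IsHamiltonianWith σ ⁅u, v⁆ (fun x => σ.toForm x ![u x, v x]) := by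
  -- `σ(u, v)` is smooth as the `0`-form `ι_v ι_u σ`.
  refine ⟨(interior v (interior u σ.toForm)).contMDiff_apply_empty, fun x w => ?_⟩
  obtain ⟨X, rfl⟩ := VField.exists_apply_eq x w
  have h1 := d_one_apply (interior u σ.toForm) v X x
  have h2 := d_two_apply σ.toForm u v X x
  have h3 := d_one_apply (interior v σ.toForm) u X x
  rw [(isSymplectic_iff σ u).1 hu] at h1
  rw [(isSymplectic_iff σ v).1 hv] at h3
  rw [σ.closed] at h2
  change (0 : ℝ) = _ at h1
  change (0 : ℝ) = _ at h2
  change (0 : ℝ) = _ at h3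
  simp only [interior_apply] at h1 h3 ⊢
  rw [σ.toForm.two_swap x (⁅u, X⁆ x), σ.toForm.two_swap x (⁅v, X⁆ x)] at h2
  have e : (fun y => σ.toForm y ![v y, u y]) = fun y => -σ.toForm y ![u y, v y] :=
    funext fun y => σ.toForm.two_swap y _ _
  rw [e, mvfderiv_fun_neg] at h3
  change (0 : ℝ) = _ - -(mvfderiv 𝓘(ℝ, E) (fun y => σ.toForm y ![u y, v y]) x (X x)) - _ at h3
  -- The combination is `dσ(u, v, X) - d(ι_v σ)(u, X) + d(ι_u σ)(v, X) = 0`, which leaves `-σ([u,v],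
  -- X) - X(σ(u, v)) = 0`.
  linarith

end

/-! ### Inverting the contraction with a symplectic form -/

/-- The map `v ↦ η(v, ·)` from vectors to covectors defined by an alternating bilinear form `η`. -/
def flat : (E [⋀^Fin 2]→L[ℝ] ℝ) →L[ℝ] E →L[ℝ] E →L[ℝ] ℝ :=
  (ContinuousLinearMap.compL ℝ E (E [⋀^Fin 1]→L[ℝ] ℝ) (E →L[ℝ] ℝ)
    (ContinuousAlternatingMap.ofSubsingletonLIE (𝕜 := ℝ) (E := E) (F := ℝ) (0 : Fin 1)).symm.toContinuousLinearEquiv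
      |>.comp
    (ContinuousAlternatingMap.curryLeftLI (𝕜 := ℝ) (E := E) (F := ℝ) (n := 1)).toContinuousLinearMap)

omit [FiniteDimensional ℝ E] in
theorem flat_apply (η : E [⋀^Fin 2]→L[ℝ] ℝ) (v w : E) : flat η v w = η ![v, w] := by
  change η _ = η _
  congr 1
  funext i; fin_cases i <;> rfl

/-- Non-degeneracy is injectivity, and `E` and its dual have equal finite dimension. -/
theorem isInvertible_flat {η : E [⋀^Fin 2]→L[ℝ] ℝ} (h : ∀ v, (∀ w, η ![v, w] = 0) → v = 0) :
    (flat η).IsInvertible := by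
  have hinj : Function.Injective (flat η : E →ₗ[ℝ] E →L[ℝ] ℝ) := by
    rw [injective_iff_map_eq_zero]
    intro v hv
    refine h v fun w => ?_
    rw [← flat_apply]
    exact congrArg (fun L : E →L[ℝ] ℝ => L w) hv
  have hfr : Module.finrank ℝ E = Module.finrank ℝ (E →L[ℝ] ℝ) := by
    rw [← LinearEquiv.finrank_eq (LinearMap.toContinuousLinearMap (𝕜 := ℝ) (E := E) (F' := ℝ))]
    exact (Subspace.dual_finrank_eq (K := ℝ) (V := E)).symm
  refine ⟨(LinearEquiv.ofInjectiveOfFinrankEq _ hinj hfr).toContinuousLinearEquiv, ?_⟩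
  ext v w
  rfl

omit [FiniteDimensional ℝ E] [IsManifold 𝓘(ℝ, E) ∞ M] in
theorem inChart_apply_one (α : Form E M 1) (x₀ : M) (y w : E) :
    inChart α x₀ y ![w] = α ((extChartAt 𝓘(ℝ, E) x₀).symm y)
      ![mfderiv 𝓘(ℝ, E) 𝓘(ℝ, E) (extChartAt 𝓘(ℝ, E) x₀).symm y w] := by
  change α _ _ = α _ _
  congr 1
  funext i; fin_cases i; rfl

omit [FiniteDimensional ℝ E] [IsManifold 𝓘(ℝ, E) ∞ M] in
theorem inChart_apply_two (α : Form E M 2) (x₀ : M) (y v w : E) :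
    inChart α x₀ y ![v, w] = α ((extChartAt 𝓘(ℝ, E) x₀).symm y)
      ![mfderiv 𝓘(ℝ, E) 𝓘(ℝ, E) (extChartAt 𝓘(ℝ, E) x₀).symm y v,
        mfderiv 𝓘(ℝ, E) 𝓘(ℝ, E) (extChartAt 𝓘(ℝ, E) x₀).symm y w] := by
  change α _ _ = α _ _
  congr 1
  funext i; fin_cases i <;> rfl

theorem isInvertible_flat_inChart (σ : SymplecticForm E M) {x₀ : M} {y : E}
    (hy : y ∈ (extChartAt 𝓘(ℝ, E) x₀).target) :
    (flat (inChart σ.toForm x₀ y)).IsInvertible := by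
  have hinv := isInvertible_mfderiv_extChartAt_symm hy
  refine isInvertible_flat fun v hv => hinv.injective (Eq.trans ?_ (map_zero _).symm)
  refine σ.nondegenerate _ _ fun w => ?_
  obtain ⟨w, rfl⟩ := hinv.surjective w
  exact (inChart_apply_two σ.toForm x₀ y v w).symm.trans (hv w)

/-- The vector `v` with `η(v, ·) = θ`, for a non-degenerate form `η`. -/
def sharp (η : E [⋀^Fin 2]→L[ℝ] ℝ) (θ : E [⋀^Fin 1]→L[ℝ] ℝ) : E :=
  -- `inverse` is total, with value `0` off the invertible maps, so `sharp` needs no proof of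
  -- non-degeneracy and can be differentiated in `η`.
  (flat η).inverse
    ((ContinuousAlternatingMap.ofSubsingletonLIE (𝕜 := ℝ) (E := E) (F := ℝ) (0 : Fin 1)).symm θ)

omit [FiniteDimensional ℝ E] in
theorem apply_sharp {η : E [⋀^Fin 2]→L[ℝ] ℝ} (h : (flat η).IsInvertible)
    (θ : E [⋀^Fin 1]→L[ℝ] ℝ) (w : E) : η ![sharp η θ, w] = θ ![w] := by
  rw [← flat_apply, sharp, h.self_apply_inverse]
  change θ _ = θ _
  congr 1
  funext i; fin_cases i; rfl

/-- Inversion of continuous linear maps is smooth at invertible ones, and `flat` is itself linear in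
the form. -/
theorem contDiffAt_sharp {η : E → E [⋀^Fin 2]→L[ℝ] ℝ} {θ : E → E [⋀^Fin 1]→L[ℝ] ℝ} {y : E}
    (hη : ContDiffAt ℝ ∞ η y) (hθ : ContDiffAt ℝ ∞ θ y) (h : (flat (η y)).IsInvertible) :
    ContDiffAt ℝ ∞ (fun z => sharp (η z) (θ z)) y := by
  have : CompleteSpace E := FiniteDimensional.complete ℝ E
  have hflat : ContDiff ℝ ∞ (fun ξ : E [⋀^Fin 2]→L[ℝ] ℝ => flat ξ) :=
    ContinuousLinearMap.contDiff (𝕜 := ℝ) (E := E [⋀^Fin 2]→L[ℝ] ℝ) (F := E →L[ℝ] E →L[ℝ] ℝ) flat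
  have h1 : ContDiffAt ℝ ∞ (fun z => flat (η z)) y := hflat.contDiffAt.comp y hη
  have h2 : ContDiffAt ℝ ∞ (fun z => (flat (η z)).inverse) y :=
    h.contDiffAt_map_inverse.comp (f := fun z => flat (η z)) y h1
  exact h2.clm_apply ((ContinuousAlternatingMap.ofSubsingletonLIE (𝕜 := ℝ) (E := E) (F := ℝ)
    (0 : Fin 1)).symm.contDiff.contDiffAt.comp y hθ)

/-- In a chart, the vector field `v` with `σ(v, ·) = β` is given by `sharp`. -/
theorem mfderiv_sharp_inChart (σ : SymplecticForm E M) (β : Form E M 1)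
    {v : (x : M) → TangentSpace 𝓘(ℝ, E) x}
    (hv : ∀ (x : M) (w : TangentSpace 𝓘(ℝ, E) x), σ.toForm x ![v x, w] = β x ![w])
    {x₀ : M} {y : E} (hy : y ∈ (extChartAt 𝓘(ℝ, E) x₀).target) :
    mfderiv 𝓘(ℝ, E) 𝓘(ℝ, E) (extChartAt 𝓘(ℝ, E) x₀).symm y
        (sharp (E := E) (inChart σ.toForm x₀ y) (inChart β x₀ y)) =
      v ((extChartAt 𝓘(ℝ, E) x₀).symm y) := by
  set p := (extChartAt 𝓘(ℝ, E) x₀).symm y with hp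
  -- Both vectors have the same contraction with `σ` at `p`, and that contraction is injective.
  have hinj := (isInvertible_flat (E := E) (σ.nondegenerate p)).injective
  refine hinj (ContinuousLinearMap.ext fun w => ?_)
  obtain ⟨w, rfl⟩ := (isInvertible_mfderiv_extChartAt_symm hy).surjective w
  refine (flat_apply (E := E) (σ.toForm p) _ _).trans
    (Eq.trans ?_ (flat_apply (E := E) (σ.toForm p) _ _).symm)
  refine (inChart_apply_two σ.toForm x₀ y _ w).symm.trans ?_
  refine (apply_sharp (isInvertible_flat_inChart σ hy) _ w).trans ?_
  exact (inChart_apply_one β x₀ y w).trans (hv p _).symm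

/-- Every `1`-form is the contraction of a symplectic form with a vector field. -/
theorem SymplecticForm.interiorₗ_surjective (σ : SymplecticForm E M) :
    Function.Surjective (interiorₗ σ.toForm) := by
  intro β
  have : CompleteSpace E := FiniteDimensional.complete ℝ E
  have : IsManifold 𝓘(ℝ, E) 1 M := .of_le (n := ∞) (by simp)
  let v : (x : M) → TangentSpace 𝓘(ℝ, E) x := fun x => sharp (E := E) (σ.toForm x) (β x)
  have hv (x : M) (w : TangentSpace 𝓘(ℝ, E) x) : σ.toForm x ![v x, w] = β x ![w] :=
    apply_sharp (E := E) (isInvertible_flat (E := E) (σ.nondegenerate x)) _ _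
  refine ⟨⟨v, fun x₀ => ?_⟩, Form.one_ext hv⟩
  have hx := mem_extChartAt_target (I := 𝓘(ℝ, E)) x₀
  have hxn := (isOpen_extChartAt_target (I := 𝓘(ℝ, E)) x₀).mem_nhds hx
  have hV := contDiffAt_sharp ((σ.toForm.2 x₀).contDiffAt hxn) ((β.2 x₀).contDiffAt hxn)
    (isInvertible_flat_inChart σ hx)
  -- `v` is built pointwise; near `x₀` it is the pullback by the chart of the smooth `sharp` field
  -- on `E`, hence smooth.
  have h := ContMDiffAt.mpullback_vectorField_preimage (n := ∞) (m := ∞)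
    (f := extChartAt 𝓘(ℝ, E) x₀) (x₀ := x₀)
    (contMDiffAt_vectorSpace_iff_contDiffAt.2 hV) contMDiffAt_extChartAt
    (isInvertible_mfderiv_extChartAt (mem_extChartAt_source x₀)) (by simp)
  refine h.congr_of_eventuallyEq ?_
  filter_upwards [extChartAt_source_mem_nhds (I := 𝓘(ℝ, E)) x₀] with x hx
  congr 1
  obtain ⟨y, hy, rfl⟩ : ∃ y ∈ (extChartAt 𝓘(ℝ, E) x₀).target,
      (extChartAt 𝓘(ℝ, E) x₀).symm y = x :=
    ⟨_, (extChartAt 𝓘(ℝ, E) x₀).map_source hx, (extChartAt 𝓘(ℝ, E) x₀).left_inv hx⟩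
  symm
  refine ((isInvertible_mfderiv_extChartAt hx).inverse_apply_eq).2 ?_
  rw [(extChartAt 𝓘(ℝ, E) x₀).right_inv hy, ← mfderiv_sharp_inChart σ β hv hy]
  have h1 := mfderiv_extChartAt_comp_mfderivWithin_extChartAt_symm (I := 𝓘(ℝ, E)) hy
  rw [ModelWithCorners.range_eq_univ, mfderivWithin_univ] at h1
  exact (congrArg (fun L : E →L[ℝ] E =>
    L (sharp (inChart σ.toForm x₀ y) (inChart β x₀ y))) h1).symm

/-! ### The Lie algebras and the quotient -/

section
variable [T2Space M]

/-- The Lie algebra of symplectic vector fields. -/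
def symplecticFields (σ : SymplecticForm E M) : LieSubalgebra ℝ (VField E M) where
  __ := LinearMap.ker (d 1 ∘ₗ interiorₗ σ.toForm)
  lie_mem' {u v} hu hv := (isSymplectic_iff σ _).1 (IsHamiltonian.isSymplectic
    ⟨_, ((isSymplectic_iff σ u).2 hu).bracket ((isSymplectic_iff σ v).2 hv)⟩)

theorem mem_symplecticFields {σ : SymplecticForm E M} {v : VField E M} :
    v ∈ symplecticFields σ ↔ IsSymplectic σ v :=
  (isSymplectic_iff σ v).symm

/-- The linear map `v ↦ ι_v σ` from symplectic vector fields to closed `1`-forms. -/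
def toClosedForm (σ : SymplecticForm E M) :
    symplecticFields σ →ₗ[ℝ] LinearMap.ker (d (E := E) (M := M) 1) :=
  (interiorₗ σ.toForm).restrict (p := (symplecticFields σ).toSubmodule) fun _ hv => hv

theorem toClosedForm_surjective (σ : SymplecticForm E M) :
    Function.Surjective (toClosedForm σ) := fun ⟨β, hβ⟩ => by
  obtain ⟨v, rfl⟩ := σ.interiorₗ_surjective β
  exact ⟨⟨v, hβ⟩, rfl⟩

/-- The linear map `v ↦ [ι_v σ]` from symplectic vector fields to the first cohomology. -/
def toDeRhamH1 (σ : SymplecticForm E M) : symplecticFields σ →ₗ[ℝ] DeRhamH1 E M :=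
  Submodule.mkQ _ ∘ₗ toClosedForm σ

theorem toDeRhamH1_eq_zero_iff (σ : SymplecticForm E M) (v : symplecticFields σ) :
    toDeRhamH1 σ v = 0 ↔ IsHamiltonian σ v := by
  rw [isHamiltonian_iff]
  exact Submodule.Quotient.mk_eq_zero _

/-- The Lie ideal of Hamiltonian vector fields. -/
def hamiltonianFields (σ : SymplecticForm E M) : LieIdeal ℝ (symplecticFields σ) where
  __ := LinearMap.ker (toDeRhamH1 σ)
  -- A bracket of two symplectic fields is already Hamiltonian; the same fact makes the quotient
  -- abelian below.
  lie_mem {u v} _ := (toDeRhamH1_eq_zero_iff σ _).2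
    ⟨_, (mem_symplecticFields.1 u.2).bracket (mem_symplecticFields.1 v.2)⟩

theorem mem_hamiltonianFields {σ : SymplecticForm E M} {v : symplecticFields σ} :
    v ∈ hamiltonianFields σ ↔ IsHamiltonian σ v :=
  toDeRhamH1_eq_zero_iff σ v

/-- The isomorphism between symplectic modulo Hamiltonian vector fields and the first
cohomology. -/
def quotientEquivDeRhamH1 (σ : SymplecticForm E M) :
    (symplecticFields σ ⧸ hamiltonianFields σ) ≃ₗ[ℝ] DeRhamH1 E M :=
  (toDeRhamH1 σ).quotKerEquivOfSurjective
    ((Submodule.mkQ_surjective _).comp (toClosedForm_surjective σ))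

theorem isLieAbelian_quotient (σ : SymplecticForm E M) :
    IsLieAbelian (symplecticFields σ ⧸ hamiltonianFields σ) where
  trivial a b := by
    obtain ⟨u, rfl⟩ := LieSubmodule.Quotient.surjective_mk' _ a
    obtain ⟨v, rfl⟩ := LieSubmodule.Quotient.surjective_mk' _ b
    change LieSubmodule.Quotient.mk ⁅u, v⁆ = 0
    exact (LieSubmodule.Quotient.mk_eq_zero _).2 (mem_hamiltonianFields.2
      ⟨_, (mem_symplecticFields.1 u.2).bracket (mem_symplecticFields.1 v.2)⟩)

end
end Symplectic
end Symplectic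
end

theorem mainTheorem1
    {E : Type*} [NormedAddCommGroup E] [NormedSpace ℝ E] [FiniteDimensional ℝ E]
    {M : Type*} [TopologicalSpace M] [T2Space M] [SecondCountableTopology M]
    [ChartedSpace E M] [IsManifold 𝓘(ℝ, E) ∞ M] (σ : Symplectic.SymplecticForm E M) :
    (∀ v₁ v₂ : Symplectic.VField E M,
      Symplectic.IsSymplectic σ v₁ → Symplectic.IsSymplectic σ v₂ →
        Symplectic.IsHamiltonianWith σ ⁅v₁, v₂⁆ (fun x => σ.toForm x ![v₁ x, v₂ x])) ∧
    (∀ v : Symplectic.VField E M, Symplectic.IsHamiltonian σ v → Symplectic.IsSymplectic σ v) ∧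
    ∃ (sym : LieSubalgebra ℝ (Symplectic.VField E M)) (ham : LieIdeal ℝ sym),
      (∀ v, v ∈ sym ↔ Symplectic.IsSymplectic σ v) ∧
      (∀ v : sym, v ∈ ham ↔ Symplectic.IsHamiltonian σ v) ∧
      IsLieAbelian (sym ⧸ ham) ∧
      ∃ e : (sym ⧸ ham) ≃ₗ[ℝ] Symplectic.DeRhamH1 E M,
        ∀ v : sym, ∃ h : Symplectic.d 1 (Symplectic.interior (v : Symplectic.VField E M) σ.toForm) = 0,
          e (LieSubmodule.Quotient.mk v) =
            Submodule.Quotient.mk ⟨Symplectic.interior (v : Symplectic.VField E M) σ.toForm, h⟩ :=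
  ⟨fun _ _ h₁ h₂ => h₁.bracket h₂, fun _ h => h.isSymplectic, Symplectic.symplecticFields σ,
    Symplectic.hamiltonianFields σ, fun _ => Symplectic.mem_symplecticFields,
    fun _ => Symplectic.mem_hamiltonianFields, Symplectic.isLieAbelian_quotient σ,
    -- `v.2` is closedness itself, as `symplecticFields` is defined as the kernel of `v ↦ d(ι_v σ)`;
    -- the quotient map then computes definitionally.
    Symplectic.quotientEquivDeRhamH1 σ, fun v => ⟨v.2, rfl⟩⟩
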